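/- Let $k\ge 2$ and let $M_k^k$ be a nonsingular hypersurface of degree $k$ in $\mathbb{CP}^{k-1}$, with hyperplane class $h$ and holomorphic tangent bundle $T'M_k^k$. Its total Chern class is $c(T'M_k^k)=\frac{(1+h)^k}{1+kh}$, and $\int_{M_k^k}h^{k-2}=k$. Let $c_T(z)$ be the monomial in $z$ of degree $k-2$ with $c_T(h)=c_{k-2}(T'M_k^k)$, and let $\chi(M_k^k)=\int_{M_k^k}c_{k-2}(T'M_k^k)$ be the Euler number, so that $c_T(z)=\frac{\chi(M_k^k)}{k}z^{k-2}$. Put $e_k(x,y)=\prod_{j=0}^{k}(jx+(k-j)y)$. For $d\ge 1$ let $P_d$ be the set of partitions $\sigma=(d_1\ge\dots\ge d_l>0)$ of $d$, where $l=l(\sigma)$, and put $\mathrm{Sym}(\sigma)=\frac{(l-1)!}{\prod_{j=1}^{d}\mathrm{mul}(\sigma;j)!}$, where $\mathrm{mul}(\sigma;j)$ is the multiplicity of $j$ in $\sigma$. The graphs of type (i) of degree $d$ are the star graphs $\Gamma=\Gamma_\sigma$, one for each $\sigma\in P_d$: an elliptic vertex at the centre with variable $z_0$, and $l$ tails, the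 $i$-th one having $d_i$ edges and vertices with variables $z_{i,1},\dots,z_{i,d_i}$ (counted from the centre; $z_{i,0}=z_0$). The integrand of $\Gamma_\sigma$ (without operator insertions) is the rational function $$f_{\Gamma_\sigma}=\mathrm{Sym}(\sigma)\,\frac1{24}\,\frac{c_T(z_0)}{(kz_0)^{l-1}}\prod_{i=1}^{l}\frac{e_k(z_0,z_{i,1})}{z_{i,1}-z_0}\;\prod_{i=1}^{l}\prod_{j=1}^{d_i-1}\frac{e_k(z_{i,j},z_{i,j+1})}{(2z_{i,j}-z_{i,j-1}-z_{i,j+1})\,kz_{i,j}}\;\cdot\frac1{z_0^{k}}\prod_{i=1}^{l}\prod_{j=1}^{d_i}\frac1{z_{i,j}^{k}} .$$ Its residue $\mathrm{Res}(f_{\Gamma_\sigma})$ is defined as follows. First take the residue at $z_0=0$. Then, for each $i$ and in ascending order of $j=1,\dots,d_i-1$, replace the function by the sum of its residues in the variable $z_{i,j}$ at $z_{i,j}=0$ and at $z_{i,j}=\frac{z_{i,j-1}+z_{i,j+1}}2$, where $z_{i,j-1}$ stands for the value at which its own residue was taken; that is, by the sum of the residues at $z_{i,j}=\frac{m}{m+1}z_{i,j+1}$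 for $m=0,1,\dots,j$. For each $i$, finish with the residue at $z_{i,d_i}=0$. The tails are treated one after the other. Then every $\mathrm{Res}(f_{\Gamma_\sigma})$ is a rational number, and, as formal power series in $e^{x}$, $$\sum_{d=1}^{\infty}\Bigl(\sum_{\sigma\in P_d}\mathrm{Res}(f_{\Gamma_\sigma})\Bigr)e^{dx}=\frac{\chi(M_k^k)}{24}\,\log\tilde L_0^{k,k}(e^x),\qquad \tilde L_0^{k,k}(e^x)=\sum_{d=0}^{\infty}\frac{(kd)!}{(d!)^k}\,e^{dx}.$$ -/

import Mathlib

open scoped Nat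

noncomputable section

namespace StarGraph

/-! ### Rational functions in the vertex variables and their residues -/

/-- Vertices of star graphs: `none` is the central elliptic vertex, `some (i, j)` with `j ≥ 1` is
the `j`-th vertex, counted from the centre, of the `i`-th tail (tails are numbered from `0`). -/
abbrev Vertex : Type := Option (ℕ × ℕ)

/-- The field of rational functions over `ℂ` in one variable for each vertex. -/
abbrev K : Type := FractionRing (MvPolynomial Vertex ℂ)

/-- The variable attached to a vertex. -/
def Z (v : Vertex) : K := algebraMap (MvPolynomial Vertex ℂ) K (MvPolynomial.X v)

/-- The variable `z_{i,j}`, with the convention `z_{i,0} = z_0` (the variable of the centre). -/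
def z (i j : ℕ) : K := if j = 0 then Z none else Z (some (i, j))

/-- A polynomial in all the variables, read as a rational function of the variable of `v` alone,
the other variables being constants. -/
def univariatePoly (v : Vertex) : MvPolynomial Vertex ℂ →+* RatFunc K :=
  MvPolynomial.eval₂Hom (RatFunc.C.comp (algebraMap ℂ K))
    (fun u => if u = v then RatFunc.X else RatFunc.C (Z u))

theorem univariatePoly_injective (v : Vertex) : Function.Injective (univariatePoly v) := by
  let g : MvPolynomial Vertex ℂ →+* Polynomial K :=
    MvPolynomial.eval₂Hom (Polynomial.C.comp (algebraMap ℂ K))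
      (fun u => if u = v then Polynomial.X else Polynomial.C (Z u))
  have h1 : (Polynomial.evalRingHom (Z v)).comp g = algebraMap (MvPolynomial Vertex ℂ) K := by
    apply MvPolynomial.ringHom_ext
    · intro r
      simp only [g, RingHom.comp_apply, MvPolynomial.coe_eval₂Hom, MvPolynomial.eval₂_C,
        Polynomial.coe_evalRingHom, Polynomial.eval_C]
      exact IsScalarTower.algebraMap_apply ℂ (MvPolynomial Vertex ℂ) K r
    · intro u
      by_cases h : u = v
      · subst h
        simp [g, Z]
      · simp [g, Z, h]
  have h2 : (algebraMap (Polynomial K) (RatFunc K)).comp g = univariatePoly v := by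
    apply MvPolynomial.ringHom_ext
    · intro r
      simp [g, univariatePoly]
    · intro u
      by_cases h : u = v
      · simp [g, univariatePoly, h]
      · simp [g, univariatePoly, h]
  have h3 : Function.Injective g := by
    have h : Function.Injective ((Polynomial.evalRingHom (Z v)).comp g) := by
      rw [h1]
      exact IsFractionRing.injective (MvPolynomial Vertex ℂ) K
    rw [RingHom.coe_comp] at h
    exact h.of_comp
  rw [← h2, RingHom.coe_comp]
  exact (RatFunc.algebraMap_injective K).comp h3

/-- A rational function of all the variables, read as a rational function of the variable of `v`
alone, the other variables being constants. -/
def univariate (v : Vertex) : K →+* RatFunc K :=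
  IsFractionRing.lift (univariatePoly_injective v)

/-- The residue at `a` of a rational function `f` of one variable `t`: the coefficient of
`(t - a)⁻¹` in the Laurent expansion of `f` at `t = a`. -/
def ratFuncResidue {F : Type*} [Field F] (a : F) (f : RatFunc F) : F :=
  ((RatFunc.laurent a f : RatFunc F) : LaurentSeries F).coeff (-1)

/-- The residue of `F` at the point `a` in the variable of `v`; the point may depend on the other
variables. -/
def residue (v : Vertex) (a : K) (F : K) : K := ratFuncResidue a (univariate v F)

/-! ### Chern classes of a nonsingular hypersurface of degree `k` in `CP^{N-1}` -/

/-- The total Chern class `(1 + h)^N / (1 + k h)` of the holomorphic tangent bundle, written as a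
power series in the hyperplane class `h`. -/
def totalChern (N k : ℕ) : PowerSeries ℚ :=
  (1 + PowerSeries.X) ^ N * (1 + (k : PowerSeries ℚ) * PowerSeries.X)⁻¹

/-- The number `c` for which the top Chern class is `c · h^{N-2}`. -/
def topChernCoeff (N k : ℕ) : ℚ := PowerSeries.coeff (N - 2) (totalChern N k)

/-- Integration over the hypersurface of a class written in terms of `h`: only the top degree
`N - 2` contributes, and `h^{N-2}` has integral `k`. -/
def hypersurfaceIntegral (N k : ℕ) (p : PowerSeries ℚ) : ℚ := k * PowerSeries.coeff (N - 2) p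

/-- The Euler number: the integral of the top Chern class. -/
def eulerNumber (N k : ℕ) : ℚ :=
  hypersurfaceIntegral N k (PowerSeries.monomial (N - 2) (topChernCoeff N k))

/-- The monomial `c_T(x)`: the top Chern class with `h` replaced by `x`. -/
def cT (N k : ℕ) (x : K) : K := (topChernCoeff N k : K) * x ^ (N - 2)

/-! ### Integrands and residues of star graphs with an elliptic centre -/

/-- `e_k(x, y) = ∏_{j=0}^{k} (j x + (k - j) y)`. -/
def e (k : ℕ) (x y : K) : K :=
  ∏ j ∈ Finset.range (k + 1), ((j : K) * x + ((k : K) - (j : K)) * y)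

/-- The parts `d_1 ≥ d_2 ≥ ⋯ ≥ d_l` of a partition, in this order. -/
def partsList {d : ℕ} (σ : d.Partition) : List ℕ := σ.parts.sort (· ≥ ·)

/-- The length `l` of a partition. -/
def len {d : ℕ} (σ : d.Partition) : ℕ := (partsList σ).length

/-- The `i`-th part of a partition, numbered from `0`; it is the number of edges of the `i`-th tail
of the star graph of the partition. -/
def part {d : ℕ} (σ : d.Partition) (i : ℕ) : ℕ := (partsList σ).getD i 0

/-- The symmetry factor `(l - 1)! / ∏_{j=1}^{d} mul(σ; j)!`. -/
def symFactor {d : ℕ} (σ : d.Partition) : ℚ :=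
  ((len σ - 1)! : ℚ) / ∏ j ∈ Finset.Icc 1 d, ((σ.parts.count j)! : ℚ)

/-- The integrand, without operator insertions, of the star graph of `σ` with an elliptic vertex as
its centre, for a degree `k` hypersurface in `CP^{N-1}`. -/
def integrand (N k : ℕ) {d : ℕ} (σ : d.Partition) : K :=
  (symFactor σ : K) * (1 / 24) * (cT N k (Z none) / ((k : K) * Z none) ^ (len σ - 1))
    * (∏ i ∈ Finset.range (len σ), e k (Z none) (z i 1) / (z i 1 - Z none))
    * (∏ i ∈ Finset.range (len σ), ∏ j ∈ Finset.Icc 1 (part σ i - 1),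
        e k (z i j) (z i (j + 1)) /
          ((2 * z i j - z i (j - 1) - z i (j + 1)) * ((k : K) * z i j)))
    * (1 / Z none ^ N)
    * ∏ i ∈ Finset.range (len σ), ∏ j ∈ Finset.Icc 1 (part σ i), 1 / z i j ^ N

/-- The residues in `z_{i,1}, …, z_{i,n}`, in this order, each step adding up the residues at
`z_{i,j} = 0` and at `z_{i,j} = (z_{i,j-1} + z_{i,j+1}) / 2`. Here `z_{i,j-1}` has been eliminated
already: `z_{i,0} = 0`, and if `z_{i,j-1} = (m / (m + 1)) z_{i,j}`, then
`2 z_{i,j} = z_{i,j-1} + z_{i,j+1}` means `z_{i,j} = ((m + 1) / (m + 2)) z_{i,j+1}`. So the points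
for `z_{i,j}` are `(m / (m + 1)) z_{i,j+1}` with `0 ≤ m ≤ j`, that is
`0, z_{i,j+1} / 2, 2 z_{i,j+1} / 3, …`. -/
def innerResidue (i : ℕ) : ℕ → K → K
  | 0, F => F
  | n + 1, F =>
      ∑ m ∈ Finset.range (n + 2),
        residue (some (i, n + 1)) ((m : K) / ((m : K) + 1) * z i (n + 2)) (innerResidue i n F)

/-- The residues in all the variables of the `i`-th tail, which has `n ≥ 1` edges; the last one is
taken at `z_{i,n} = 0` only. -/
def tailResidue (i n : ℕ) (F : K) : K :=
  residue (some (i, n)) 0 (innerResidue i (n - 1) F)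

/-- The residue at `z_0 = 0`, followed by those in the variables of the first `l` tails, where the
`i`-th tail has `D i` edges. -/
def iteratedResidue (D : ℕ → ℕ) : ℕ → K → K
  | 0, F => residue none 0 F
  | l + 1, F => tailResidue l (D l) (iteratedResidue D l F)

/-- The residue `Res(f_Γ)` of the integrand of the star graph `Γ` of `σ` with elliptic centre. -/
def starResidue (N k : ℕ) {d : ℕ} (σ : d.Partition) : K :=
  iteratedResidue (part σ) (len σ) (integrand N k σ)

/-- The series `∑_{d ≥ 0} (k d)! / (d!)^k q^d`, where `q` stands for `e^x`. -/
def L0 (k : ℕ) : PowerSeries ℚ :=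
  PowerSeries.mk fun d => ((k * d)! : ℚ) / ((d ! : ℚ) ^ k)

end StarGraph

end

/-!
All the poles at which residues are taken are simple. Before the residue in `z_{i,j}` is taken, a
tail has become a combination of functions `chainTerm k m`, `0 ≤ m < j`, in which
`z_{i,j-1} = (m / (m + 1)) z_{i,j}`. The denominator of the `j`-th vertex then equals
`((m + 2) / (m + 1)) z_{i,j} - z_{i,j+1}`, so the only poles are at `0` and at
`((m + 1) / (m + 2)) z_{i,j+1}`: the state `m` passes to the states `0` and `m + 1`. Since
`e_k(x, y) / (k x y^k)` takes the value `a_{m+1} / a_m` at `x = (m / (m + 1)) y`, where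
`L̃_0 = ∑ a_d q^d`, the weight of the state `m` telescopes to `a_{m+1}` times a coefficient of
`1 / L̃_0`, and a whole tail of length `d` contributes the `d`-th coefficient of `1 - 1 / L̃_0`.

The symmetry factor is `1 / l` times the number of orderings of the parts of `σ`. So the sum over
partitions is `∑_l (1 - 1 / L̃_0)^l / l = -log (1 / L̃_0) = log L̃_0`.
-/

noncomputable section

namespace StarGraph

open Finset (range Icc Ico)

/-! ### Residues of rational functions of one variable -/

section OneVariable

variable {F : Type*} [Field F]

/-- The Laurent expansion at `a` of a rational function of one variable, as a ring homomorphism;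
`ratFuncResidue a` is its coefficient of degree `-1`. -/
def laurentExpansion (a : F) : RatFunc F →+* LaurentSeries F where
  toFun f := ((RatFunc.laurent a f : RatFunc F) : LaurentSeries F)
  map_zero' := by simp only [map_zero]
  map_one' := by simp only [map_one]
  map_add' f g := by simp only [map_add]
  map_mul' f g := by simp only [map_mul]

theorem ratFuncResidue_eq_coeff (a : F) (f : RatFunc F) :
    ratFuncResidue a f = (laurentExpansion a f).coeff (-1) := rfl

theorem laurentExpansion_algebraMap (a : F) (p : Polynomial F) :
    laurentExpansion a (algebraMap _ _ p)
      = ((Polynomial.taylor a p : PowerSeries F) : LaurentSeries F) := by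
  rw [RatFunc.coe_coe]
  exact congrArg (fun f : RatFunc F => (f : LaurentSeries F)) (RatFunc.laurent_algebraMap a p)

theorem laurentExpansion_C (a c : F) :
    laurentExpansion a (RatFunc.C c) = ((PowerSeries.C c : PowerSeries F) : LaurentSeries F) := by
  rw [← RatFunc.algebraMap_C, laurentExpansion_algebraMap, Polynomial.taylor_C, Polynomial.coe_C]

theorem laurentExpansion_X (a : F) :
    laurentExpansion a RatFunc.X
      = ((PowerSeries.X + PowerSeries.C a : PowerSeries F) : LaurentSeries F) := by
  rw [← RatFunc.algebraMap_X, laurentExpansion_algebraMap, Polynomial.taylor_X, Polynomial.coe_add,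
    Polynomial.coe_C, Polynomial.coe_X]

theorem ratFuncResidue_sum {ι : Type*} (a : F) (s : Finset ι) (f : ι → RatFunc F) :
    ratFuncResidue a (∑ i ∈ s, f i) = ∑ i ∈ s, ratFuncResidue a (f i) := by
  simp only [ratFuncResidue_eq_coeff, map_sum, HahnSeries.coeff_sum]

theorem ratFuncResidue_C_mul (a c : F) (f : RatFunc F) :
    ratFuncResidue a (RatFunc.C c * f) = c * ratFuncResidue a f := by
  rw [ratFuncResidue_eq_coeff, ratFuncResidue_eq_coeff, map_mul, laurentExpansion_C,
    PowerSeries.coe_C, HahnSeries.C_mul_eq_smul, HahnSeries.coeff_smul, smul_eq_mul]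

/-- `HasValueAt f b a` says that the rational function `f` is regular at `a`, with value `b`. It is
phrased with Laurent expansions, so that residues at simple poles can be read off. -/
def HasValueAt (f : RatFunc F) (b a : F) : Prop :=
  ∃ p : PowerSeries F,
    laurentExpansion a f = (p : LaurentSeries F) ∧ PowerSeries.constantCoeff p = b

namespace HasValueAt

variable {f g : RatFunc F} {a b c : F}

theorem const (c a : F) : HasValueAt (RatFunc.C c) c a :=
  ⟨_, laurentExpansion_C a c, PowerSeries.constantCoeff_C c⟩

theorem X (a : F) : HasValueAt RatFunc.X a a :=
  ⟨_, laurentExpansion_X a, by simp⟩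

theorem add (hf : HasValueAt f b a) (hg : HasValueAt g c a) : HasValueAt (f + g) (b + c) a := by
  obtain ⟨p, hp, rfl⟩ := hf
  obtain ⟨q, hq, rfl⟩ := hg
  exact ⟨p + q, by rw [map_add, hp, hq, PowerSeries.coe_add], map_add _ _ _⟩

theorem sub (hf : HasValueAt f b a) (hg : HasValueAt g c a) : HasValueAt (f - g) (b - c) a := by
  obtain ⟨p, hp, rfl⟩ := hf
  obtain ⟨q, hq, rfl⟩ := hg
  exact ⟨p - q, by rw [map_sub, hp, hq, PowerSeries.coe_sub], map_sub _ _ _⟩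

theorem mul (hf : HasValueAt f b a) (hg : HasValueAt g c a) : HasValueAt (f * g) (b * c) a := by
  obtain ⟨p, hp, rfl⟩ := hf
  obtain ⟨q, hq, rfl⟩ := hg
  exact ⟨p * q, by rw [map_mul, hp, hq, PowerSeries.coe_mul], map_mul _ _ _⟩

theorem inv (hf : HasValueAt f b a) (hb : b ≠ 0) : HasValueAt f⁻¹ b⁻¹ a := by
  obtain ⟨p, hp, rfl⟩ := hf
  refine ⟨p⁻¹, ?_, PowerSeries.constantCoeff_inv p⟩
  rw [map_inv₀, hp]
  refine inv_eq_of_mul_eq_one_right ?_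
  rw [← PowerSeries.coe_mul, PowerSeries.mul_inv_cancel _ hb, PowerSeries.coe_one]

theorem div (hf : HasValueAt f b a) (hg : HasValueAt g c a) (hc : c ≠ 0) :
    HasValueAt (f / g) (b / c) a := by
  rw [div_eq_mul_inv, div_eq_mul_inv]
  exact hf.mul (hg.inv hc)

theorem one (a : F) : HasValueAt 1 1 a := by
  simpa only [map_one] using const (1 : F) a

theorem natCast (n : ℕ) (a : F) : HasValueAt (n : RatFunc F) n a := by
  simpa only [map_natCast] using const (n : F) a

theorem prod {ι : Type*} (s : Finset ι) {f : ι → RatFunc F} {b : ι → F}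
    (h : ∀ i ∈ s, HasValueAt (f i) (b i) a) : HasValueAt (∏ i ∈ s, f i) (∏ i ∈ s, b i) a := by
  classical
  induction s using Finset.induction_on with
  | empty => exact one a
  | insert i s hi ih =>
    rw [Finset.prod_insert hi, Finset.prod_insert hi]
    exact (h i (Finset.mem_insert_self i s)).mul
      (ih fun j hj => h j (Finset.mem_insert_of_mem hj))

theorem pow (hf : HasValueAt f b a) (n : ℕ) : HasValueAt (f ^ n) (b ^ n) a := by
  simpa only [Finset.prod_const, Finset.card_range] using prod (range n) fun _ _ => hf

theorem ratFuncResidue_eq_zero (hf : HasValueAt f b a) : ratFuncResidue a f = 0 := by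
  obtain ⟨p, hp, -⟩ := hf
  rw [ratFuncResidue_eq_coeff, hp, PowerSeries.coeff_coe, if_pos (by norm_num)]

theorem ratFuncResidue_inv_mul (hf : HasValueAt f b a) :
    ratFuncResidue a ((RatFunc.X - RatFunc.C a)⁻¹ * f) = b := by
  obtain ⟨p, hp, rfl⟩ := hf
  have hX : laurentExpansion a (RatFunc.X - RatFunc.C a) = HahnSeries.single 1 1 := by
    rw [map_sub, laurentExpansion_X, laurentExpansion_C, ← PowerSeries.coe_sub,
      add_sub_cancel_right, PowerSeries.coe_X]
  have hshift := HahnSeries.coeff_single_mul_add (Γ := ℤ) (r := (1 : F))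
    (x := (p : LaurentSeries F)) (a := 0) (b := -1)
  rw [zero_add] at hshift
  rw [ratFuncResidue_eq_coeff, map_mul, map_inv₀, hX, hp, HahnSeries.inv_single, inv_one, hshift,
    one_mul, PowerSeries.coeff_coe]
  simp

theorem ratFuncResidue_zero_X_inv_mul (hf : HasValueAt f c 0) (hb : b ≠ 0) :
    ratFuncResidue 0 (RatFunc.X⁻¹ * ((RatFunc.X - RatFunc.C b)⁻¹ * f)) = -(c / b) := by
  have hsub := (X 0).sub (const b 0)
  rw [zero_sub] at hsub
  have hres := ((hsub.inv (neg_ne_zero.mpr hb)).mul hf).ratFuncResidue_inv_mul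
  rw [map_zero, sub_zero] at hres
  rw [hres, inv_neg, neg_mul, div_eq_inv_mul]

theorem ratFuncResidue_X_inv_mul (hf : HasValueAt f c b) (hb : b ≠ 0) :
    ratFuncResidue b (RatFunc.X⁻¹ * ((RatFunc.X - RatFunc.C b)⁻¹ * f)) = c / b := by
  rw [mul_left_comm, (((X b).inv hb).mul hf).ratFuncResidue_inv_mul, div_eq_inv_mul]

theorem ratFuncResidue_X_inv_mul_eq_zero (hf : HasValueAt f c a) (ha : a ≠ 0) (hab : a ≠ b) :
    ratFuncResidue a (RatFunc.X⁻¹ * ((RatFunc.X - RatFunc.C b)⁻¹ * f)) = 0 :=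
  (((X a).inv ha).mul
    ((((X a).sub (const b a)).inv (sub_ne_zero.mpr hab)).mul hf)).ratFuncResidue_eq_zero

end HasValueAt

end OneVariable

/-! ### The factors of a tail -/

theorem coeff_L0 (k d : ℕ) : PowerSeries.coeff d (L0 k) = ((k * d)! : ℚ) / ((d ! : ℚ) ^ k) :=
  PowerSeries.coeff_mk _ _

theorem coeff_L0_ne_zero (k d : ℕ) : PowerSeries.coeff d (L0 k) ≠ 0 := by
  rw [coeff_L0]
  positivity

theorem constantCoeff_L0 (k : ℕ) : PowerSeries.constantCoeff (L0 k) = 1 := by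
  rw [← PowerSeries.coeff_zero_eq_constantCoeff_apply, coeff_L0]
  simp

/-- The quotient `a_{m+1} / a_m` of consecutive coefficients of `L̃_0 = ∑ a_d q^d`; it is the value
of `e_k(x, y) / (k x y^k)` at `x = (m / (m + 1)) y`. -/
def growth (k m : ℕ) : ℚ := PowerSeries.coeff (m + 1) (L0 k) / PowerSeries.coeff m (L0 k)

/-- The quotient `m / (m + 1)` of consecutive variables of a tail at a point where a residue is
taken. -/
def ratio {F : Type*} [Field F] (m : ℕ) : F := (m : F) / ((m : F) + 1)

/-- `e_k(x, y)` without its factor `k x`. -/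
def reducedE {R : Type*} [CommRing R] (k : ℕ) (x y : R) : R :=
  ∏ j ∈ range k, ((j : R) * x + ((k : R) - (j : R)) * y)

theorem e_eq_mul_reducedE (k : ℕ) (x y : K) : e k x y = k * x * reducedE k x y := by
  rw [e, Finset.prod_range_succ, reducedE]
  ring

theorem map_reducedE {R S : Type*} [CommRing R] [CommRing S] (f : R →+* S) (k : ℕ) (x y : R) :
    f (reducedE k x y) = reducedE k (f x) (f y) := by
  simp only [reducedE, map_prod, map_add, map_mul, map_sub, map_natCast]

theorem reducedE_mul_mul {R : Type*} [CommRing R] (k : ℕ) (x y c : R) :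
    reducedE k (x * c) (y * c) = reducedE k x y * c ^ k := by
  rw [reducedE, reducedE, Finset.pow_eq_prod_const, ← Finset.prod_mul_distrib]
  exact Finset.prod_congr rfl fun j _ => by ring

theorem coeff_L0_succ_mul_pow (k m : ℕ) :
    PowerSeries.coeff (m + 1) (L0 k) * (m + 1 : ℚ) ^ k
      = (k * (m + 1)).descFactorial k * PowerSeries.coeff m (L0 k) := by
  have hfact := Nat.factorial_mul_descFactorial (n := k * (m + 1)) (k := k)
    (Nat.le_mul_of_pos_right _ (Nat.succ_pos _))
  rw [mul_add_one, Nat.add_sub_cancel, ← mul_add_one] at hfact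
  rw [coeff_L0, coeff_L0, ← hfact, Nat.factorial_succ]
  push_cast
  rw [mul_pow]
  field_simp

theorem reducedE_ratio_one_mul_pow (k m : ℕ) :
    reducedE k (ratio m) (1 : ℚ) * (m + 1 : ℚ) ^ k = (k * (m + 1)).descFactorial k := by
  rw [← reducedE_mul_mul, one_mul, ratio, div_mul_cancel₀ _ (Nat.cast_add_one_ne_zero m),
    Nat.descFactorial_eq_prod_range, Nat.cast_prod, reducedE]
  refine Finset.prod_congr rfl fun j hj => ?_
  rw [Nat.cast_sub ((Finset.mem_range.mp hj).le.trans
    (Nat.le_mul_of_pos_right _ (Nat.succ_pos _)))]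
  push_cast
  ring

theorem growth_eq_reducedE (k m : ℕ) : growth k m = reducedE k (ratio m) 1 := by
  have hm : (m + 1 : ℚ) ^ k ≠ 0 := pow_ne_zero k (Nat.cast_add_one_ne_zero m)
  rw [growth, div_eq_iff (coeff_L0_ne_zero k m)]
  apply mul_right_cancel₀ hm
  rw [coeff_L0_succ_mul_pow, mul_right_comm, reducedE_ratio_one_mul_pow]

section Field

variable {F G : Type*} [Field F] [Field G]

theorem map_ratio (f : F →+* G) (m : ℕ) : f (ratio m) = ratio m := by
  simp only [ratio, map_div₀, map_add, map_natCast, map_one]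

theorem ratio_zero : (ratio 0 : F) = 0 := by
  rw [ratio, Nat.cast_zero, zero_div]

/-- The factor of the vertex of a tail with variable `x`, whose neighbours have the variables `w`
(towards the centre) and `y`, times the power of `y` in the denominator. The factor `k x`, common to
`e_k(x, y)` and the denominator, is cancelled. -/
def edge (k : ℕ) (w x y : F) : F := reducedE k x y / ((2 * x - w - y) * y ^ k)

/-- The product of the factors `edge` of `r` consecutive vertices of a tail, with variables
`y 0, …, y (r - 1)`, where `w` is the variable before `y 0`. -/
def chain (k : ℕ) : F → (ℕ → F) → ℕ → F
  | _, _, 0 => 1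
  | w, y, r + 1 => edge k w (y 0) (y 1) * chain k (y 0) (fun s => y (s + 1)) r

/-- What is left of a tail if `m / (m + 1)` times `y 0` has been substituted for the variable
before `y 0`, up to a constant. -/
def chainTerm (k m : ℕ) (y : ℕ → F) (r : ℕ) : F := (y 0)⁻¹ * chain k (ratio m * y 0) y r

/-- The factor of the integrand that belongs to a tail with `d` edges and variables `y 0, y 1, …`,
without the factor `k w` of `e_k(w, y 0)`, where `w` is the variable of the centre. -/
def tailFactor (k : ℕ) (w : F) (y : ℕ → F) (d : ℕ) : F :=
  reducedE k w (y 0) / ((y 0 - w) * y 0 ^ k) * chain k w y (d - 1)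

theorem chain_eq_prod (k : ℕ) (y : ℕ → F) (r : ℕ) :
    chain k (y 0) (fun s => y (s + 1)) r
      = ∏ j ∈ range r, edge k (y j) (y (j + 1)) (y (j + 2)) := by
  induction r generalizing y with
  | zero => rfl
  | succ r ih => rw [chain, ih fun s => y (s + 1), Finset.prod_range_succ', mul_comm]

theorem map_edge (f : F →+* G) (k : ℕ) (w x y : F) :
    f (edge k w x y) = edge k (f w) (f x) (f y) := by
  simp only [edge, map_div₀, map_mul, map_sub, map_pow, map_reducedE, map_ofNat]

theorem map_chain (f : F →+* G) (k : ℕ) (w : F) (y : ℕ → F) (r : ℕ) :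
    f (chain k w y r) = chain k (f w) (fun s => f (y s)) r := by
  induction r generalizing w y with
  | zero => exact map_one f
  | succ r ih => rw [chain, map_mul, map_edge, ih, chain]

theorem map_chainTerm (f : F →+* G) (k m : ℕ) (y : ℕ → F) (r : ℕ) :
    f (chainTerm k m y r) = chainTerm k m (fun s => f (y s)) r := by
  rw [chainTerm, map_mul, map_inv₀, map_chain, map_mul, map_ratio, chainTerm]

theorem map_tailFactor (f : F →+* G) (k : ℕ) (w : F) (y : ℕ → F) (d : ℕ) :
    f (tailFactor k w y d) = tailFactor k (f w) (fun s => f (y s)) d := by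
  simp only [tailFactor, map_mul, map_div₀, map_sub, map_pow, map_reducedE, map_chain]

namespace HasValueAt

variable {f g h : RatFunc F} {a b c d : F}

theorem reducedE (hf : HasValueAt f b a) (hg : HasValueAt g c a) (k : ℕ) :
    HasValueAt (reducedE k f g) (reducedE k b c) a :=
  prod _ fun j _ => ((natCast j a).mul hf).add (((natCast k a).sub (natCast j a)).mul hg)

theorem edge (hf : HasValueAt f b a) (hg : HasValueAt g c a) (hh : HasValueAt h d a) (k : ℕ)
    (hd : d ≠ 0) (hpole : 2 * c - b - d ≠ 0) :
    HasValueAt (edge k f g h) (edge k b c d) a :=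
  (hg.reducedE hh k).div (((((natCast 2 a).mul hg).sub hf).sub hh).mul (hh.pow k))
    (mul_ne_zero hpole (pow_ne_zero k hd))

theorem chain (hf : HasValueAt f b a) (k : ℕ) {y : ℕ → F} (hy : y 1 ≠ 0)
    (hpole : 2 * y 0 - b - y 1 ≠ 0) (r : ℕ) :
    HasValueAt (chain k f (fun s => RatFunc.C (y s)) r) (chain k b y r) a := by
  cases r with
  | zero => exact one a
  | succ r =>
    rw [StarGraph.chain, ← map_chain]
    exact (hf.edge (const _ a) (const _ a) k hy hpole).mul (const _ a)

theorem tailFactor (hf : HasValueAt f b a) (k : ℕ) {y : ℕ → F} (hy₀ : y 0 ≠ 0) (hy₁ : y 1 ≠ 0)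
    (hb : y 0 - b ≠ 0) (hpole : 2 * y 0 - b - y 1 ≠ 0) (d : ℕ) :
    HasValueAt (tailFactor k f (fun s => RatFunc.C (y s)) d) (tailFactor k b y d) a :=
  ((hf.reducedE (const _ a) k).div (((const _ a).sub hf).mul ((const _ a).pow k))
    (mul_ne_zero hb (pow_ne_zero k hy₀))).mul (hf.chain k hy₁ hpole _)

end HasValueAt

variable [CharZero F]

theorem ratio_succ_ne_zero (m : ℕ) : (ratio (m + 1) : F) ≠ 0 :=
  div_ne_zero (Nat.cast_ne_zero.mpr (Nat.succ_ne_zero m)) (Nat.cast_add_one_ne_zero _)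

theorem ratio_injective : Function.Injective (ratio : ℕ → F) := by
  intro m n h
  rw [ratio, ratio, div_eq_div_iff (Nat.cast_add_one_ne_zero m) (Nat.cast_add_one_ne_zero n)] at h
  exact Nat.cast_injective (R := F) (by linear_combination h)

theorem two_sub_ratio (m : ℕ) : 2 - ratio m = (ratio (m + 1) : F)⁻¹ := by
  have hm : (m : F) + 1 ≠ 0 := Nat.cast_add_one_ne_zero m
  rw [ratio, ratio, inv_div, Nat.cast_succ, eq_div_iff hm, sub_mul, div_mul_cancel₀ _ hm]
  ring

theorem reducedE_ratio_mul (k m : ℕ) (y : F) :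
    reducedE k (ratio m * y) y = (growth k m : F) * y ^ k := by
  have hgrowth : (growth k m : F) = reducedE k (ratio m) 1 := by
    rw [growth_eq_reducedE, ← eq_ratCast (Rat.castHom F), map_reducedE, map_ratio, map_one]
  rw [hgrowth, ← reducedE_mul_mul, one_mul]

theorem edge_ratio_mul (k m : ℕ) (x y : F) :
    edge k (ratio m * x) x y
      = ratio (m + 1) * reducedE k x y / ((x - ratio (m + 1) * y) * y ^ k) := by
  have hden : 2 * x - ratio m * x - y = (ratio (m + 1))⁻¹ * (x - ratio (m + 1) * y) := by
    rw [mul_sub, inv_mul_cancel_left₀ (ratio_succ_ne_zero m), ← two_sub_ratio]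
    ring
  rw [edge, hden, mul_assoc, div_mul_eq_div_div, div_inv_eq_mul, mul_comm (reducedE k x y)]

theorem tailFactor_zero (k : ℕ) {y : ℕ → F} (hy : y 0 ≠ 0) (d : ℕ) :
    tailFactor k 0 y d = (growth k 0 : F) * chainTerm k 0 y (d - 1) := by
  have hE := reducedE_ratio_mul k 0 (y 0)
  rw [ratio_zero, zero_mul] at hE
  rw [tailFactor, chainTerm, ratio_zero, zero_mul, sub_zero, hE,
    mul_div_mul_right _ _ (pow_ne_zero k hy), div_eq_mul_inv, mul_assoc]

/-! ### The residue in one variable of a tail -/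

/-- The coefficient of the term of state `n` in the residue at `x = (n / (n + 1)) y` of a term of
state `m`, where a term has state `m` if `m / (m + 1)` times its first variable has been
substituted for the variable before it. -/
def transfer (k m n : ℕ) : ℚ :=
  if n = 0 then -growth k 0 else if n = m + 1 then growth k (m + 1) else 0

theorem chainTerm_succ_eq (k m : ℕ) (x : ℕ → F) (r : ℕ) :
    chainTerm k m x (r + 1) = (x 0)⁻¹ * ((x 0 - ratio (m + 1) * x 1)⁻¹
      * (ratio (m + 1) * (reducedE k (x 0) (x 1) / x 1 ^ k)
        * chain k (x 0) (fun s => x (s + 1)) r)) := by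
  rw [chainTerm, chain, edge_ratio_mul, div_mul_eq_div_div_swap, div_eq_mul_inv, mul_div_assoc]
  ring

section Step

variable {x : ℕ → RatFunc F} {y : ℕ → F}

theorem hasValueAt_regularPart (k m n r : ℕ) (hy : y 0 ≠ 0) (hy₁ : y 1 ≠ 0)
    (hpole : 2 * y 0 - ratio n * y 0 - y 1 ≠ 0) :
    HasValueAt (RatFunc.C (ratio (m + 1))
        * (reducedE k RatFunc.X (RatFunc.C (y 0)) / RatFunc.C (y 0) ^ k)
        * chain k RatFunc.X (fun s => RatFunc.C (y s)) r)
      (ratio (m + 1) * growth k n * chain k (ratio n * y 0) y r) (ratio n * y 0) := by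
  have hX := HasValueAt.X (ratio n * y 0)
  have hy₀ := HasValueAt.const (y 0) (ratio n * y 0)
  have hE := (hX.reducedE hy₀ k).div (hy₀.pow k) (pow_ne_zero k hy)
  rw [reducedE_ratio_mul, mul_div_cancel_right₀ _ (pow_ne_zero k hy)] at hE
  exact ((HasValueAt.const (ratio (m + 1)) _).mul hE).mul (hX.chain k hy₁ hpole r)

theorem ratFuncResidue_chainTerm (k m n r : ℕ) (hy : y 0 ≠ 0) (hy₁ : y 1 ≠ 0)
    (hpole : 2 * y 0 - ratio n * y 0 - y 1 ≠ 0) (hx₀ : x 0 = RatFunc.X)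
    (hx : ∀ s, x (s + 1) = RatFunc.C (y s)) :
    ratFuncResidue (ratio n * y 0) (chainTerm k m x (r + 1))
      = (transfer k m n : F) * chainTerm k n y r := by
  have hρ := ratio_succ_ne_zero (F := F) m
  have hreg := hasValueAt_regularPart k m n r hy hy₁ hpole
  rw [chainTerm_succ_eq, hx₀, show x 1 = _ from hx 0, ← map_ratio RatFunc.C, ← map_mul, transfer,
    chainTerm]
  simp only [hx]
  split_ifs with hn hnm
  · subst hn
    rw [ratio_zero, zero_mul] at hreg ⊢
    rw [hreg.ratFuncResidue_zero_X_inv_mul (mul_ne_zero hρ hy), mul_assoc (ratio (m + 1)),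
      mul_div_mul_left _ _ hρ, Rat.cast_neg]
    ring
  · subst hnm
    rw [hreg.ratFuncResidue_X_inv_mul (mul_ne_zero hρ hy), mul_assoc (ratio (m + 1)),
      mul_div_mul_left _ _ hρ]
    ring
  · have hρn : (ratio n : F) ≠ 0 := ratio_zero (F := F) ▸ ratio_injective.ne hn
    rw [hreg.ratFuncResidue_X_inv_mul_eq_zero (mul_ne_zero hρn hy)
      ((mul_left_injective₀ hy).ne (ratio_injective.ne hnm)), Rat.cast_zero, zero_mul]

end Step

end Field

/-! ### Iterated residues -/

theorem univariate_Z (u v : Vertex) :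
    univariate v (Z u) = if u = v then RatFunc.X else RatFunc.C (Z u) := by
  simp [univariate, Z, univariatePoly]

theorem Z_ne_of_univariate_eq_C {v : Vertex} {a b : K} (h : univariate v a = RatFunc.C b) :
    Z v ≠ a := by
  rintro rfl
  rw [univariate_Z, if_pos rfl, ← RatFunc.algebraMap_X, ← RatFunc.algebraMap_C] at h
  exact Polynomial.X_ne_C _ (RatFunc.algebraMap_injective K h)

theorem Z_ne_zero (v : Vertex) : Z v ≠ 0 :=
  Z_ne_of_univariate_eq_C (b := 0) (by rw [map_zero, map_zero])

theorem z_succ (i j : ℕ) : z i (j + 1) = Z (some (i, j + 1)) := if_neg j.succ_ne_zero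

theorem z_succ_ne_zero (i j : ℕ) : z i (j + 1) ≠ 0 := z_succ i j ▸ Z_ne_zero _

theorem univariate_z_self (i j : ℕ) : univariate (some (i, j + 1)) (z i (j + 1)) = RatFunc.X := by
  rw [z_succ, univariate_Z, if_pos rfl]

theorem univariate_z_of_ne {v : Vertex} {i j : ℕ} (h : v ≠ some (i, j + 1)) :
    univariate v (z i (j + 1)) = RatFunc.C (z i (j + 1)) := by
  rw [z_succ, univariate_Z, if_neg h.symm]

theorem residue_sum {ι : Type*} (v : Vertex) (a : K) (s : Finset ι) (f : ι → K) :
    residue v a (∑ i ∈ s, f i) = ∑ i ∈ s, residue v a (f i) := by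
  simp only [residue, map_sum, ratFuncResidue_sum]

theorem residue_const_mul {v : Vertex} {c : K} (hc : univariate v c = RatFunc.C c) (a f : K) :
    residue v a (c * f) = c * residue v a f := by
  rw [residue, map_mul, hc, ratFuncResidue_C_mul, residue]

theorem residue_ratCast_mul (v : Vertex) (q : ℚ) (a f : K) :
    residue v a (q * f) = q * residue v a f :=
  residue_const_mul (by rw [map_ratCast, map_ratCast]) a f

theorem residue_zero_Z_inv (v : Vertex) : residue v 0 (Z v)⁻¹ = 1 := by
  have hres := (HasValueAt.one (0 : K)).ratFuncResidue_inv_mul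
  rw [map_zero, sub_zero, mul_one] at hres
  rw [residue, map_inv₀, univariate_Z, if_pos rfl, hres]

theorem two_mul_z_sub_ne_zero (i j : ℕ) {a : K}
    (ha : univariate (some (i, j + 2)) a = RatFunc.C a) :
    2 * z i (j + 1) - a - z i (j + 2) ≠ 0 := by
  have h : univariate (some (i, j + 2)) (2 * z i (j + 1) - a)
      = RatFunc.C (2 * z i (j + 1) - a) := by
    rw [map_sub, map_sub, map_mul, map_mul, map_ofNat, map_ofNat, ha,
      univariate_z_of_ne (by simp)]
  rw [z_succ i (j + 1)]
  exact sub_ne_zero.mpr (Z_ne_of_univariate_eq_C h).symm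

theorem residue_chainTerm (k i j m n r : ℕ) :
    residue (some (i, j + 1)) (ratio n * z i (j + 2))
        (chainTerm k m (fun s => z i (j + s + 1)) (r + 1))
      = (transfer k m n : K) * chainTerm k n (fun s => z i (j + 1 + s + 1)) r := by
  have hpole : 2 * z i (j + 2) - ratio n * z i (j + 2) - z i (j + 3) ≠ 0 := by
    refine two_mul_z_sub_ne_zero i (j + 1) ?_
    rw [map_mul, map_mul, map_ratio, map_ratio, univariate_z_of_ne (by simp)]
  have hx : ∀ s, univariate (some (i, j + 1)) (z i (j + (s + 1) + 1))
      = RatFunc.C (z i (j + 1 + s + 1)) := by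
    intro s
    rw [show j + (s + 1) = j + 1 + s by ring]
    exact univariate_z_of_ne (by simp [add_assoc])
  rw [residue, map_chainTerm]
  exact ratFuncResidue_chainTerm (y := fun s => z i (j + 1 + s + 1)) k m n r
    (z_succ_ne_zero i (j + 1)) (z_succ_ne_zero i (j + 2)) hpole (univariate_z_self i j) hx

theorem residue_prod_tailFactor (k : ℕ) (D : ℕ → ℕ) (l : ℕ) :
    residue none 0 ((Z none)⁻¹
        * ∏ i ∈ range l, tailFactor k (Z none) (fun s => z i (s + 1)) (D i))
      = ∏ i ∈ range l, tailFactor k 0 (fun s => z i (s + 1)) (D i) := by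
  have hfactor : ∀ i ∈ range l, HasValueAt
      (univariate none (tailFactor k (Z none) (fun s => z i (s + 1)) (D i)))
      (tailFactor k 0 (fun s => z i (s + 1)) (D i)) 0 := by
    intro i _
    have hz : ∀ s, univariate none (z i (s + 1)) = RatFunc.C (z i (s + 1)) :=
      fun s => univariate_z_of_ne (by simp)
    have h2 := two_mul_z_sub_ne_zero i 0 (a := 0) (by simp)
    rw [map_tailFactor, univariate_Z, if_pos rfl]
    simp only [hz]
    exact (HasValueAt.X 0).tailFactor k (z_succ_ne_zero i 0) (z_succ_ne_zero i 1)
      (by rw [sub_zero]; exact z_succ_ne_zero i 0) h2 (D i)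
  have hres := (HasValueAt.prod _ hfactor).ratFuncResidue_inv_mul
  rw [map_zero, sub_zero] at hres
  rw [residue, map_mul, map_inv₀, univariate_Z, if_pos rfl, map_prod, hres]

theorem sum_coeff_inv_L0_mul (k t : ℕ) :
    ∑ m ∈ range (t + 1), PowerSeries.coeff (t - m) (L0 k)⁻¹ * PowerSeries.coeff (m + 1) (L0 k)
      = -PowerSeries.coeff (t + 1) (L0 k)⁻¹ := by
  have hunit := congrArg (PowerSeries.coeff (t + 1)) (PowerSeries.mul_inv_cancel (L0 k)
    (by rw [constantCoeff_L0]; exact one_ne_zero))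
  rw [PowerSeries.coeff_mul, Finset.Nat.sum_antidiagonal_eq_sum_range_succ_mk,
    Finset.sum_range_succ', PowerSeries.coeff_one, if_neg t.succ_ne_zero] at hunit
  simp only [PowerSeries.coeff_zero_eq_constantCoeff_apply, constantCoeff_L0, one_mul,
    Nat.sub_zero, Nat.add_sub_add_right] at hunit
  rw [eq_neg_iff_add_eq_zero, ← hunit]
  simp only [mul_comm]

/-- The coefficient of the term of state `m` in the function left over after the residues in the
first `t` variables of a tail. -/
def chainCoeff (k t m : ℕ) : ℚ :=
  PowerSeries.coeff (t - m) (L0 k)⁻¹ * PowerSeries.coeff (m + 1) (L0 k)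

theorem growth_zero (k : ℕ) : growth k 0 = PowerSeries.coeff 1 (L0 k) := by
  rw [growth, PowerSeries.coeff_zero_eq_constantCoeff_apply, constantCoeff_L0, div_one]

theorem chainCoeff_zero_zero (k : ℕ) : chainCoeff k 0 0 = growth k 0 := by
  rw [chainCoeff, growth_zero, PowerSeries.coeff_zero_eq_constantCoeff_apply,
    PowerSeries.constantCoeff_inv, constantCoeff_L0, inv_one, one_mul]

theorem sum_chainCoeff_mul_transfer (k : ℕ) {t n : ℕ} (hn : n ≤ t + 1) :
    ∑ m ∈ range (t + 1), chainCoeff k t m * transfer k m n = chainCoeff k (t + 1) n := by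
  rcases n with _ | n
  · simp only [transfer, if_true, chainCoeff, ← Finset.sum_mul, sum_coeff_inv_L0_mul, growth_zero,
      neg_mul_neg, Nat.sub_zero, zero_add]
  · rw [Finset.sum_eq_single_of_mem n (Finset.mem_range.mpr (by omega))]
    · rw [transfer, if_neg n.succ_ne_zero, if_pos rfl, chainCoeff, chainCoeff,
        Nat.add_sub_add_right, growth, mul_assoc, mul_div_cancel₀ _ (coeff_L0_ne_zero k _)]
    · intro m _ hm
      rw [transfer, if_neg n.succ_ne_zero, if_neg (by omega), mul_zero]

theorem innerResidue_chainTerm (k i t r : ℕ) :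
    innerResidue i t ((growth k 0 : K) * chainTerm k 0 (fun s => z i (s + 1)) (t + r))
      = ∑ m ∈ range (t + 1),
        (chainCoeff k t m : K) * chainTerm k m (fun s => z i (t + s + 1)) r := by
  induction t generalizing r with
  | zero => simp only [innerResidue, zero_add, Finset.sum_range_one, chainCoeff_zero_zero]
  | succ t ih =>
    rw [innerResidue, add_right_comm, add_assoc, ih]
    refine Finset.sum_congr rfl fun n hn => ?_
    rw [residue_sum, ← sum_chainCoeff_mul_transfer k (Finset.mem_range_succ_iff.mp hn),
      Rat.cast_sum, Finset.sum_mul]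
    refine Finset.sum_congr rfl fun m _ => ?_
    rw [residue_ratCast_mul, ← ratio, residue_chainTerm, Rat.cast_mul, mul_assoc]

theorem tailResidue_tailFactor (k i : ℕ) {n : ℕ} (hn : 1 ≤ n) :
    tailResidue i n (tailFactor k 0 (fun s => z i (s + 1)) n)
      = ((-PowerSeries.coeff n (L0 k)⁻¹ : ℚ) : K) := by
  obtain ⟨t, rfl⟩ := Nat.exists_eq_add_of_le' hn
  have hinner := innerResidue_chainTerm k i t 0
  rw [add_zero] at hinner
  rw [tailResidue, tailFactor_zero k (z_succ_ne_zero i 0), Nat.add_sub_cancel, hinner, residue_sum,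
    ← sum_coeff_inv_L0_mul, Rat.cast_sum]
  refine Finset.sum_congr rfl fun m _ => ?_
  rw [residue_ratCast_mul, chainTerm, chain, mul_one, add_zero, z_succ, residue_zero_Z_inv, mul_one,
    chainCoeff]

theorem innerResidue_const_mul {i : ℕ} {c : K}
    (hc : ∀ j, univariate (some (i, j)) c = RatFunc.C c) (n : ℕ) (f : K) :
    innerResidue i n (c * f) = c * innerResidue i n f := by
  induction n with
  | zero => rfl
  | succ n ih =>
    rw [innerResidue, innerResidue, Finset.mul_sum, ih]
    exact Finset.sum_congr rfl fun m _ => residue_const_mul (hc _) _ _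

theorem tailResidue_const_mul {i : ℕ} {c : K}
    (hc : ∀ j, univariate (some (i, j)) c = RatFunc.C c) (n : ℕ) (f : K) :
    tailResidue i n (c * f) = c * tailResidue i n f := by
  rw [tailResidue, tailResidue, innerResidue_const_mul hc, residue_const_mul (hc n)]

theorem univariate_tailFactor_of_ne {i i' : ℕ} (h : i ≠ i') (j k d : ℕ) :
    univariate (some (i, j)) (tailFactor k 0 (fun s => z i' (s + 1)) d)
      = RatFunc.C (tailFactor k 0 (fun s => z i' (s + 1)) d) := by
  have hz : ∀ s, univariate (some (i, j)) (z i' (s + 1)) = RatFunc.C (z i' (s + 1)) :=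
    fun s => univariate_z_of_ne (by simp [h])
  simp only [map_tailFactor, hz, map_zero]

theorem iteratedResidue_mul_prod_tailFactor (k : ℕ) {D : ℕ → ℕ} (A : ℚ) {l n : ℕ}
    (hD : ∀ i < l, 1 ≤ D i) (hn : n ≤ l) :
    iteratedResidue D n ((A : K) * ((Z none)⁻¹
        * ∏ i ∈ range l, tailFactor k (Z none) (fun s => z i (s + 1)) (D i)))
      = ((A * ∏ i ∈ range n, -PowerSeries.coeff (D i) (L0 k)⁻¹ : ℚ) : K)
        * ∏ i ∈ Ico n l, tailFactor k 0 (fun s => z i (s + 1)) (D i) := by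
  induction n with
  | zero =>
    rw [iteratedResidue, residue_ratCast_mul, residue_prod_tailFactor, Finset.prod_range_zero,
      mul_one, Finset.range_eq_Ico]
  | succ n ih =>
    rw [iteratedResidue, ih (by omega), Finset.prod_eq_prod_Ico_succ_bot (by omega : n < l),
      mul_comm (tailFactor k 0 _ (D n)), ← mul_assoc, tailResidue_const_mul,
      tailResidue_tailFactor k n (hD n (by omega)), Finset.prod_range_succ, ← mul_assoc A,
      mul_right_comm, ← Rat.cast_mul]
    intro j
    rw [map_mul, map_mul, map_ratCast, map_ratCast, map_prod, map_prod]
    refine congrArg _ (Finset.prod_congr rfl fun i hi => univariate_tailFactor_of_ne ?_ j k (D i))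
    exact (Nat.lt_of_succ_le (Finset.mem_Ico.mp hi).1).ne

/-! ### The integrand of a star graph -/

theorem e_div_mul_one_div (k : ℕ) {x : K} (hx : (k : K) * x ≠ 0) (w y : K) :
    e k x y / ((2 * x - w - y) * (k * x)) * (1 / y ^ k) = edge k w x y := by
  rw [e_eq_mul_reducedE, mul_comm (2 * x - w - y), mul_div_mul_left _ _ hx, div_mul_div_comm,
    mul_one, edge]

theorem prod_Icc_one_eq_prod_range {M : Type*} [CommMonoid M] (f : ℕ → M) (n : ℕ) :
    ∏ j ∈ Icc 1 n, f j = ∏ j ∈ range n, f (j + 1) := by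
  rw [Finset.range_eq_Ico, Finset.prod_Ico_add' f 0 n 1]
  rfl

theorem prod_tail {k d : ℕ} (hk : k ≠ 0) (hd : 1 ≤ d) (i : ℕ) :
    e k (Z none) (z i 1) / (z i 1 - Z none)
      * (∏ j ∈ Icc 1 (d - 1), e k (z i j) (z i (j + 1)) /
          ((2 * z i j - z i (j - 1) - z i (j + 1)) * ((k : K) * z i j)))
      * (∏ j ∈ Icc 1 d, 1 / z i j ^ k)
      = k * Z none * tailFactor k (Z none) (fun s => z i (s + 1)) d := by
  obtain ⟨t, rfl⟩ := Nat.exists_eq_add_of_le' hd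
  have hchain := chain_eq_prod k (z i) t
  rw [show z i 0 = Z none from rfl] at hchain
  have hkz : ∀ j, (k : K) * z i (j + 1) ≠ 0 :=
    fun j => mul_ne_zero (Nat.cast_ne_zero.mpr hk) (z_succ_ne_zero i j)
  rw [tailFactor, div_mul_eq_div_div (reducedE _ _ _), Nat.add_sub_cancel, hchain,
    prod_Icc_one_eq_prod_range, prod_Icc_one_eq_prod_range, Finset.prod_range_succ' _ t]
  simp only [← e_div_mul_one_div k (hkz _), Nat.add_sub_cancel, Finset.prod_mul_distrib,
    zero_add, e_eq_mul_reducedE k (Z none)]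
  ring

theorem part_pos {d : ℕ} (σ : d.Partition) {i : ℕ} (hi : i < len σ) : 1 ≤ part σ i := by
  rw [part, List.getD_eq_getElem _ _ hi]
  exact σ.parts_pos ((Multiset.mem_sort (· ≥ ·)).mp (List.getElem_mem hi))

theorem len_eq_card {d : ℕ} (σ : d.Partition) : len σ = σ.parts.card :=
  Multiset.length_sort _

theorem len_pos {d : ℕ} (hd : 1 ≤ d) (σ : d.Partition) : 1 ≤ len σ := by
  rw [len_eq_card, Nat.one_le_iff_ne_zero, Ne, Multiset.card_eq_zero]
  intro hempty
  have hsum := σ.parts_sum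
  rw [hempty, Multiset.sum_zero] at hsum
  omega

theorem prod_part {M : Type*} [CommMonoid M] {d : ℕ} (σ : d.Partition) (f : ℕ → M) :
    ∏ i ∈ range (len σ), f (part σ i) = (σ.parts.map f).prod := by
  conv_rhs => rw [← Multiset.sort_eq σ.parts (· ≥ ·), Multiset.map_coe, Multiset.prod_coe]
  rw [Finset.prod_range, ← List.prod_ofFn]
  congr 1
  refine List.ext_getElem (by simp [len, partsList]) fun i h1 h2 => ?_
  rw [List.length_ofFn] at h1
  rw [List.getElem_ofFn, part, List.getD_eq_getElem _ _ h1, List.getElem_map]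
  rfl

theorem eulerNumber_eq (N k : ℕ) : eulerNumber N k = k * topChernCoeff N k := by
  rw [eulerNumber, hypersurfaceIntegral, PowerSeries.coeff_monomial_same]

theorem cT_div_mul {k l : ℕ} (hk : 2 ≤ k) (hl : 1 ≤ l) {x : K} (hx : x ≠ 0) :
    cT k k x / (k * x) ^ (l - 1) * (k * x) ^ l * (1 / x ^ k) = (eulerNumber k k : K) * x⁻¹ := by
  have hk₀ : (k : K) ≠ 0 := Nat.cast_ne_zero.mpr (by omega)
  have hxk : x ^ (k - 2) * x ^ 2 = x ^ k := pow_sub_mul_pow x hk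
  have hl' : (k * x) ^ l = (k * x) ^ (l - 1) * (k * x) := (pow_sub_one_mul (by omega) _).symm
  rw [cT, eulerNumber_eq, hl', ← hxk]
  push_cast
  field_simp

theorem integrand_eq {k d : ℕ} (hk : 2 ≤ k) (hd : 1 ≤ d) (σ : d.Partition) :
    integrand k k σ = ((symFactor σ * (eulerNumber k k / 24) : ℚ) : K) * ((Z none)⁻¹
      * ∏ i ∈ range (len σ), tailFactor k (Z none) (fun s => z i (s + 1)) (part σ i)) := by
  have hsplit : integrand k k σ
      = symFactor σ * (1 / 24) * (cT k k (Z none) / (k * Z none) ^ (len σ - 1)) * (1 / Z none ^ k)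
        * ∏ i ∈ range (len σ), k * Z none
          * tailFactor k (Z none) (fun s => z i (s + 1)) (part σ i) := by
    rw [← Finset.prod_congr rfl fun i hi =>
      prod_tail (by omega) (part_pos σ (Finset.mem_range.mp hi)) i, integrand]
    simp only [Finset.prod_mul_distrib]
    ring
  have hcentre := cT_div_mul hk (len_pos hd σ) (Z_ne_zero none)
  rw [hsplit, Finset.prod_mul_distrib, Finset.prod_const, Finset.card_range]
  push_cast
  linear_combination (symFactor σ : K) * (1 / 24)
    * (∏ i ∈ range (len σ), tailFactor k (Z none) (fun s => z i (s + 1)) (part σ i)) * hcentre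

theorem starResidue_eq {k d : ℕ} (hk : 2 ≤ k) (hd : 1 ≤ d) (σ : d.Partition) :
    starResidue k k σ = ((symFactor σ * (eulerNumber k k / 24)
      * (σ.parts.map fun j => -PowerSeries.coeff j (L0 k)⁻¹).prod : ℚ) : K) := by
  rw [starResidue, integrand_eq hk hd,
    iteratedResidue_mul_prod_tailFactor k _ (fun i hi => part_pos σ hi) le_rfl, Finset.Ico_self,
    Finset.prod_empty, mul_one, ← prod_part σ fun j => -PowerSeries.coeff j (L0 k)⁻¹]

/-! ### The logarithm of a power series -/

section Log

open PowerSeries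

variable {A : Type*} [CommRing A] [Algebra ℚ A] {f g T : PowerSeries A}

theorem derivative_log_mul_one_add_X : derivative A (log A) * (1 + X) = 1 := by
  rw [deriv_log]
  ext n
  rw [mul_add, mul_one, map_add]
  cases n with
  | zero => simp
  | succ n => simp [coeff_succ_mul_X, coeff_one, pow_succ]

theorem mul_derivative_logOf (hf : constantCoeff f = 1) :
    f * derivative A (logOf f) = derivative A f := by
  have hs : HasSubst (f - 1) := HasSubst.of_constantCoeff_zero' (by simp [hf])
  have hlog := congrArg (subst (f - 1)) (derivative_log_mul_one_add_X (A := A))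
  rw [subst_mul hs, subst_add hs, subst_X hs, ← coe_substAlgHom hs, map_one,
    add_sub_cancel] at hlog
  rw [logOf_eq, derivative_subst hs, ← coe_substAlgHom hs, mul_left_comm, ← mul_assoc, hlog,
    one_mul, map_sub, Derivation.map_one_eq_zero, sub_zero]

theorem logOf_mul (hf : constantCoeff f = 1) (hg : constantCoeff g = 1) :
    logOf (f * g) = logOf f + logOf g := by
  have hfg : constantCoeff (f * g) = 1 := by rw [map_mul, hf, hg, one_mul]
  have hunit : IsUnit (f * g) := isUnit_iff_constantCoeff.mpr (hfg ▸ isUnit_one)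
  have : IsAddTorsionFree A := IsAddTorsionFree.of_module_rat A
  refine derivative.ext (hunit.mul_left_cancel ?_) ?_
  · rw [mul_derivative_logOf hfg, map_add, Derivation.leibniz, ← mul_derivative_logOf hf,
      ← mul_derivative_logOf hg, smul_eq_mul, smul_eq_mul]
    ring
  · rw [map_add, constantCoeff_logOf hfg, constantCoeff_logOf hf, constantCoeff_logOf hg, add_zero]

theorem logOf_one : logOf (1 : PowerSeries A) = 0 := by
  have hmul := logOf_mul (map_one (constantCoeff (R := A))) (map_one constantCoeff)
  rwa [one_mul, left_eq_add] at hmul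

theorem logOf_inv {F : Type*} [Field F] [Algebra ℚ F] {f : PowerSeries F}
    (hf : constantCoeff f = 1) : logOf f⁻¹ = -logOf f := by
  have hf' : constantCoeff f⁻¹ = 1 := by rw [constantCoeff_inv, hf, inv_one]
  rw [eq_neg_iff_add_eq_zero, ← logOf_mul hf' hf,
    PowerSeries.inv_mul_cancel f (hf ▸ one_ne_zero), logOf_one]

theorem coeff_logOf_one_sub (hT : constantCoeff T = 0) (d : ℕ) :
    coeff d (logOf (1 - T)) = -∑ n ∈ Icc 1 d, (n : ℚ)⁻¹ • coeff d (T ^ n) := by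
  have hs : HasSubst (1 - T - 1) := HasSubst.of_constantCoeff_zero' (by simp [hT])
  rw [logOf_eq, coeff_subst' hs, finsum_eq_sum_of_support_subset (s := Icc 1 d),
    ← Finset.sum_neg_distrib]
  · refine Finset.sum_congr rfl fun n hn => ?_
    have hsign : (-1 : ℚ) ^ (n + 1) * (-1) ^ n = -1 := by
      rw [← pow_add, show n + 1 + n = 2 * n + 1 by ring, pow_succ, pow_mul]
      norm_num
    have hpow : (-T) ^ n = ((-1 : ℚ) ^ n) • T ^ n := by
      rw [← neg_one_smul ℚ T, smul_pow]
    rw [coeff_log, if_neg (Nat.one_le_iff_ne_zero.mp (Finset.mem_Icc.mp hn).1), sub_sub_cancel_left,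
      hpow, coeff_smul, smul_eq_mul, ← Algebra.smul_def, smul_smul, div_mul_eq_mul_div, hsign,
      neg_div, one_div, neg_smul]
  · intro n hn
    rw [Finset.coe_Icc, Set.mem_Icc]
    by_contra! hnd
    refine hn ?_
    beta_reduce
    rcases Nat.eq_zero_or_pos n with rfl | hpos
    · rw [coeff_log, if_pos rfl, zero_smul]
    · have hdvd : X ^ n ∣ (1 - T - 1) ^ n :=
        pow_dvd_pow_of_dvd (X_dvd_iff.mpr (by simp [hT])) n
      rw [X_pow_dvd_iff.mp hdvd d (hnd hpos), smul_zero]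

end Log

/-! ### Sums over partitions -/

section Partitions

open PowerSeries

variable {R : Type*} [CommSemiring R]

theorem coeff_pow_eq_of_trunc_eq {f g : PowerSeries R} {d : ℕ}
    (hfg : trunc (d + 1) f = trunc (d + 1) g) (n : ℕ) : coeff d (f ^ n) = coeff d (g ^ n) := by
  have htrunc : trunc (d + 1) (f ^ n) = trunc (d + 1) (g ^ n) := by
    rw [← trunc_trunc_pow, hfg, trunc_trunc_pow]
  simpa only [coeff_trunc, Nat.lt_succ_self, if_true] using congrArg (Polynomial.coeff · d) htrunc

theorem trunc_sum_monomial {f : PowerSeries R} (hf : constantCoeff f = 0) (d : ℕ) :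
    trunc (d + 1) (∑ j ∈ Icc 1 d, monomial j (coeff j f)) = trunc (d + 1) f := by
  ext j
  rw [coeff_trunc, coeff_trunc]
  split_ifs with hj
  · simp only [map_sum, coeff_monomial, Finset.sum_ite_eq]
    rcases Nat.eq_zero_or_pos j with rfl | hpos
    · rw [coeff_zero_eq_constantCoeff_apply, hf, ite_self]
    · exact if_pos (Finset.mem_Icc.mpr ⟨hpos, Nat.le_of_lt_succ hj⟩)
  · rfl

theorem prod_map_monomial (t : ℕ → R) (m : Multiset ℕ) :
    (m.map fun j => monomial j (t j)).prod = monomial m.sum (m.map t).prod := by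
  induction m using Multiset.induction_on with
  | empty => simp
  | cons a m ih =>
    rw [Multiset.map_cons, Multiset.prod_cons, ih, Multiset.sum_cons, Multiset.map_cons,
      Multiset.prod_cons, monomial_mul_monomial]

theorem coeff_natCast_mul_monomial (c d n : ℕ) (t : R) :
    coeff d ((c : PowerSeries R) * monomial n t) = if n = d then (c : R) * t else 0 := by
  rw [← map_natCast C, coeff_C_mul, coeff_monomial, mul_ite, mul_zero]
  exact if_congr eq_comm rfl rfl

theorem sum_sym_Icc_eq_sum_partition {M : Type*} [AddCommMonoid M] (d n : ℕ) (F : Multiset ℕ → M) :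
    ∑ m ∈ ((Icc 1 d).sym n).filter (fun m : Sym ℕ n => (m : Multiset ℕ).sum = d), F m
      = ∑ σ : d.Partition with σ.parts.card = n, F σ.parts := by
  symm
  refine Finset.sum_bij (fun σ hσ => ⟨σ.parts, (Finset.mem_filter.mp hσ).2⟩) ?_ ?_ ?_ ?_
  · intro σ _
    exact Finset.mem_filter.mpr ⟨Finset.mem_sym_iff.mpr fun j hj =>
      Finset.mem_Icc.mpr ⟨σ.parts_pos hj, σ.le_of_mem_parts hj⟩, σ.parts_sum⟩
  · intro σ _ τ _ hστ
    exact Nat.Partition.ext (congrArg Subtype.val hστ)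
  · intro m hm
    rw [Finset.mem_filter, Finset.mem_sym_iff] at hm
    exact ⟨⟨m.1, fun {j} hj => (Finset.mem_Icc.mp (hm.1 j hj)).1, hm.2⟩,
      Finset.mem_filter.mpr ⟨Finset.mem_univ _, m.2⟩, rfl⟩
  · intro σ _
    rfl

theorem coeff_pow_eq_sum_partition {f : PowerSeries R} (hf : constantCoeff f = 0) (d n : ℕ) :
    coeff d (f ^ n) = ∑ σ : d.Partition with σ.parts.card = n,
      (σ.parts.countPerms : R) * (σ.parts.map fun j => coeff j f).prod := by
  rw [coeff_pow_eq_of_trunc_eq (trunc_sum_monomial hf d).symm, Finset.sum_pow, map_sum]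
  simp only [prod_map_monomial, coeff_natCast_mul_monomial]
  rw [← Finset.sum_filter]
  exact sum_sym_Icc_eq_sum_partition d n fun m =>
    (m.countPerms : R) * (m.map fun j => coeff j f).prod

theorem symFactor_eq {d : ℕ} (hd : 1 ≤ d) (σ : d.Partition) :
    symFactor σ = (σ.parts.card : ℚ)⁻¹ * σ.parts.countPerms := by
  have hsub : σ.parts.toFinsupp.support ⊆ Icc 1 d := by
    intro j hj
    rw [Multiset.toFinsupp_support, Multiset.mem_toFinset] at hj
    exact Finset.mem_Icc.mpr ⟨σ.parts_pos hj, σ.le_of_mem_parts hj⟩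
  have hsum : ∑ j ∈ Icc 1 d, σ.parts.toFinsupp j = σ.parts.card := by
    rw [← Multiset.toFinsupp_sum_eq, Finsupp.sum_of_support_subset _ hsub _ (by simp)]
    rfl
  have hspec := Nat.multinomial_spec (Icc 1 d) σ.parts.toFinsupp
  rw [← Finsupp.multinomial_eq_of_support_subset hsub, hsum] at hspec
  have hcard : 1 ≤ σ.parts.card := len_eq_card σ ▸ len_pos hd σ
  have hperms : (∏ j ∈ Icc 1 d, ((σ.parts.count j)! : ℚ)) * σ.parts.countPerms
      = σ.parts.card * ((σ.parts.card - 1)! : ℚ) := by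
    rw [← Nat.cast_mul σ.parts.card, Nat.mul_factorial_pred (by omega), ← hspec]
    push_cast
    rfl
  rw [symFactor, len_eq_card, div_eq_iff (Finset.prod_ne_zero_iff.mpr fun j _ => by positivity),
    eq_comm, mul_assoc, inv_mul_eq_iff_eq_mul₀ (by positivity), mul_comm, hperms]

theorem card_parts_le {d : ℕ} (σ : d.Partition) : σ.parts.card ≤ d := by
  have h := Multiset.card_nsmul_le_sum (s := σ.parts) (a := 1) fun j hj => σ.parts_pos hj
  rwa [σ.parts_sum, smul_eq_mul, mul_one] at h

theorem sum_symFactor_smul {A : Type*} [CommRing A] [Algebra ℚ A] {T : PowerSeries A}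
    (hT : constantCoeff T = 0) {d : ℕ} (hd : 1 ≤ d) :
    ∑ σ : d.Partition, symFactor σ • (σ.parts.map fun j => coeff j T).prod
      = -coeff d (logOf (1 - T)) := by
  have hmaps : ∀ σ ∈ (Finset.univ : Finset d.Partition), σ.parts.card ∈ Icc 1 d := fun σ _ =>
    Finset.mem_Icc.mpr ⟨len_eq_card σ ▸ len_pos hd σ, card_parts_le σ⟩
  rw [coeff_logOf_one_sub hT, neg_neg, ← Finset.sum_fiberwise_of_maps_to hmaps]
  refine Finset.sum_congr rfl fun n _ => ?_
  rw [coeff_pow_eq_sum_partition hT, Finset.smul_sum]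
  refine Finset.sum_congr rfl fun σ hσ => ?_
  rw [symFactor_eq hd, (Finset.mem_filter.mp hσ).2, mul_smul, Nat.cast_smul_eq_nsmul,
    nsmul_eq_mul]

theorem sum_symFactor_mul_prod_neg_coeff_inv {f : PowerSeries ℚ} (hf : constantCoeff f = 1) {d : ℕ}
    (hd : 1 ≤ d) :
    ∑ σ : d.Partition, symFactor σ * (σ.parts.map fun j => -coeff j f⁻¹).prod
      = coeff d (logOf f) := by
  have hT : constantCoeff (1 - f⁻¹) = 0 := by
    rw [map_sub, map_one, constantCoeff_inv, hf, inv_one, sub_self]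
  have hsum := sum_symFactor_smul hT hd
  rw [sub_sub_cancel, logOf_inv hf, map_neg, neg_neg] at hsum
  rw [← hsum]
  refine Finset.sum_congr rfl fun σ _ => ?_
  rw [smul_eq_mul, Multiset.map_congr rfl fun j hj => ?_]
  rw [map_sub, coeff_one, if_neg (σ.parts_pos hj).ne', zero_sub]

end Partitions

end StarGraph

end

/-- The residue of every star graph with elliptic centre is a rational number `r d σ`, and the
series of their sums over the graphs of degree `d ≥ 1`, in the variable `q = e^x`, is
`χ / 24 · log L̃_0`. -/
theorem proposition2 (k : ℕ) (hk : 2 ≤ k) :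
    ∃ r : (d : ℕ) → d.Partition → ℚ,
      (∀ d : ℕ, 1 ≤ d → ∀ σ : d.Partition, StarGraph.starResidue k k σ = (r d σ : StarGraph.K)) ∧
      PowerSeries.mk (fun d : ℕ => if d = 0 then 0 else ∑ σ : d.Partition, r d σ) =
        PowerSeries.C (StarGraph.eulerNumber k k / 24) * PowerSeries.logOf (StarGraph.L0 k) := by
  refine ⟨fun d σ => StarGraph.symFactor σ * (StarGraph.eulerNumber k k / 24)
      * (σ.parts.map fun j => -PowerSeries.coeff j (StarGraph.L0 k)⁻¹).prod,
    fun d hd σ => StarGraph.starResidue_eq hk hd σ, ?_⟩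
  have hL0 := StarGraph.constantCoeff_L0 k
  ext d
  rw [PowerSeries.coeff_mk, PowerSeries.coeff_C_mul]
  split_ifs with hd
  · rw [hd, PowerSeries.coeff_zero_eq_constantCoeff_apply, PowerSeries.constantCoeff_logOf hL0,
      mul_zero]
  · rw [← StarGraph.sum_symFactor_mul_prod_neg_coeff_inv hL0 (Nat.one_le_iff_ne_zero.mpr hd),
      Finset.mul_sum]
    exact Finset.sum_congr rfl fun σ _ => by ring
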